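/- A \emph{bitopological space} is a set $S$ with two topologies $\mathcal T^+$ and $\mathcal T^-$. Put $\mathcal L^+=\{U\in\mathcal T^+ : S\setminus U\in\mathcal T^-\}$ and $\mathcal L^-=\{U\in\mathcal T^- : S\setminus U\in\mathcal T^+\}$. A non-empty bitopological space $(S,\mathcal T^+,\mathcal T^-)$ is an \emph{abstract spectrum} if (SP1) $\mathcal L^+$ is a base for $\mathcal T^+$ and $\mathcal L^-$ is a base for $\mathcal T^-$; (SP2) every $\mathcal T^+$-closed subset of $S$ is compact in $(S,\mathcal T^-)$, and every $\mathcal T^-$-closed subset of $S$ is compact in $(S,\mathcal T^+)$ (compact: every open cover has a finite subcover); (SP3) at least one of $(S,\mathcal T^+)$ and $(S,\mathcal T^-)$ is a $T_0$-space. Let $\mathbf S$ be the category of abstract spectra, whose morphisms are the maps that are continuous both for the topologies $\mathcal T^+$ and for the topologies $\mathcal T^-$, and let $\mathbf S_\emptyset$ be the category obtained in the same way when the empty bitopological space is admitted as an abstract spectrum. Let $\mathbf{DLat}$ be the category of distributive lattices with $0$ and $1$ (where $0=1$ is allowed) and lattice homomorphisms preserving $0$ and $1$, and let $\mathbf{DLat}_{0\ne1}$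 be its full subcategory of lattices with $0\neq 1$. \textbf{Corollary 2.3.12.} The categories $\mathbf S_\emptyset$ and $\mathbf{DLat}$ are dually equivalent, i.e. $\mathbf S_\emptyset^{\mathrm{op}}$ is equivalent to $\mathbf{DLat}$; and the categories $\mathbf S$ and $\mathbf{DLat}_{0\ne1}$ are dually equivalent. -/

import Mathlib

open CategoryTheory Topology

universe u

/-- A bitopological space `(S, 𝒯⁺, 𝒯⁻)`: a set with two topologies (no further condition). -/
structure BitopSpace where
  carrier : Type u
  pos : TopologicalSpace carrier
  neg : TopologicalSpace carrier

namespace BitopSpace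

/-- `ℒ⁺`: the `𝒯⁺`-open sets whose complement is `𝒯⁻`-open. -/
def posLat (X : BitopSpace.{u}) : Set (Set X.carrier) :=
  {U | IsOpen[X.pos] U ∧ IsOpen[X.neg] Uᶜ}

/-- `ℒ⁻`: the `𝒯⁻`-open sets whose complement is `𝒯⁺`-open. -/
def negLat (X : BitopSpace.{u}) : Set (Set X.carrier) :=
  {U | IsOpen[X.neg] U ∧ IsOpen[X.pos] Uᶜ}

/-- Maps continuous for both the positive and the negative topologies. -/
@[ext]
structure Hom (X Y : BitopSpace.{u}) where
  toFun : X.carrier → Y.carrier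
  continuous_pos : @Continuous X.carrier Y.carrier X.pos Y.pos toFun
  continuous_neg : @Continuous X.carrier Y.carrier X.neg Y.neg toFun

/-- Bitopological spaces and bicontinuous maps, with composition of functions. -/
instance : Category BitopSpace.{u} where
  Hom X Y := Hom X Y
  id X := ⟨id, @continuous_id _ X.pos, @continuous_id _ X.neg⟩
  comp {X Y Z} f g := ⟨g.toFun ∘ f.toFun,
    @Continuous.comp _ _ _ X.pos Y.pos Z.pos _ _ g.continuous_pos f.continuous_pos,
    @Continuous.comp _ _ _ X.neg Y.neg Z.neg _ _ g.continuous_neg f.continuous_neg⟩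

/-- The axioms of an abstract spectrum, apart from non-emptiness. -/
structure SpectrumAxioms (X : BitopSpace.{u}) : Prop where
  /-- `ℒ⁺` is a base for `𝒯⁺`. -/
  basis_pos : @TopologicalSpace.IsTopologicalBasis X.carrier X.pos X.posLat
  /-- `ℒ⁻` is a base for `𝒯⁻`. -/
  basis_neg : @TopologicalSpace.IsTopologicalBasis X.carrier X.neg X.negLat
  /-- `𝒯⁺`-closed sets are `𝒯⁻`-compact (every open cover has a finite subcover). -/
  compact_neg : ∀ F : Set X.carrier, IsOpen[X.pos] Fᶜ → @IsCompact X.carrier X.neg F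
  /-- `𝒯⁻`-closed sets are `𝒯⁺`-compact. -/
  compact_pos : ∀ F : Set X.carrier, IsOpen[X.neg] Fᶜ → @IsCompact X.carrier X.pos F
  /-- At least one of the two topologies is `T₀`. -/
  t0 : @T0Space X.carrier X.pos ∨ @T0Space X.carrier X.neg

/-- Abstract spectra: non-empty bitopological spaces satisfying the axioms. -/
def isAbstractSpectrum : ObjectProperty BitopSpace.{u} :=
  fun X => Nonempty X.carrier ∧ X.SpectrumAxioms

/-- The same axioms, with the empty bitopological space admitted. -/
def isPossiblyEmptyAbstractSpectrum : ObjectProperty BitopSpace.{u} :=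
  fun X => X.SpectrumAxioms

end BitopSpace

/-- The category of (non-empty) abstract spectra; its morphisms are the bicontinuous maps. -/
abbrev AbstractSpectrum : Type (u + 1) :=
  BitopSpace.isAbstractSpectrum.{u}.FullSubcategory

/-- The category of abstract spectra, together with the empty one. -/
abbrev PossiblyEmptyAbstractSpectrum : Type (u + 1) :=
  BitopSpace.isPossiblyEmptyAbstractSpectrum.{u}.FullSubcategory

/-- Bounded distributive lattices with `0 ≠ 1`. -/
def BddDistLat.isNontrivial : ObjectProperty BddDistLat.{u} :=
  fun L => (⊥ : L) ≠ ⊤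

/-- The full subcategory of bounded distributive lattices with `0 ≠ 1`. -/
abbrev NontrivialBddDistLat : Type (u + 1) :=
  BddDistLat.isNontrivial.{u}.FullSubcategory

open Set TopologicalSpace Filter

namespace BitopSpace

/-! The duality sends a spectrum to `ℒ⁺` and a bicontinuous map to its preimage map. In a spectrum
every prime filter of `ℒ⁺` consists of the members containing one point: the point exists by
compactness (`exists_point`) and is unique by T₀ (`ext_posLat`). Evaluation at `x` followed back
along a homomorphism `ℒ⁺(Y) → ℒ⁺(X)` is a prime filter, whose point is the image of `x`; so the
functor is fully faithful. It is essentially surjective because a lattice is `ℒ⁺` of its prime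
filter space: the prime ideal theorem makes `basicOpen` injective, compactness makes it surjective.
-/

/-- `ℒ⁺` as a sublattice of the power set. -/
def posSublattice (X : BitopSpace.{u}) : Sublattice (Set X.carrier) where
  carrier := X.posLat
  supClosed' U hU V hV := by
    let _ := X.pos
    refine ⟨hU.1.union hV.1, ?_⟩
    let _ := X.neg
    change IsOpen (U ∪ V)ᶜ
    rw [compl_union]
    exact hU.2.inter hV.2
  infClosed' U hU V hV := by
    let _ := X.pos
    refine ⟨hU.1.inter hV.1, ?_⟩
    let _ := X.neg
    change IsOpen (U ∩ V)ᶜ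
    rw [compl_inter]
    exact hU.2.union hV.2

theorem univ_mem_posSublattice (X : BitopSpace.{u}) : univ ∈ X.posSublattice :=
  ⟨@isOpen_univ _ X.pos, by rw [compl_univ]; exact @isOpen_empty _ X.neg⟩

theorem empty_mem_posSublattice (X : BitopSpace.{u}) : ∅ ∈ X.posSublattice :=
  ⟨@isOpen_empty _ X.pos, by rw [compl_empty]; exact @isOpen_univ _ X.neg⟩

instance (X : BitopSpace.{u}) : BoundedOrder X.posSublattice where
  top := ⟨univ, X.univ_mem_posSublattice⟩
  le_top U := subset_univ (U : Set X.carrier)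
  bot := ⟨∅, X.empty_mem_posSublattice⟩
  bot_le U := empty_subset (U : Set X.carrier)

/-- Taking preimages along a bicontinuous map, as a homomorphism between the lattices `ℒ⁺`. -/
def Hom.preimage {X Y : BitopSpace.{u}} (f : Hom X Y) :
    BoundedLatticeHom Y.posSublattice X.posSublattice where
  toFun U := ⟨f.toFun ⁻¹' U,
    @IsOpen.preimage _ _ X.pos Y.pos _ f.continuous_pos _ U.2.1,
    @IsOpen.preimage _ _ X.neg Y.neg _ f.continuous_neg _ U.2.2⟩
  map_sup' _ _ := rfl
  map_inf' _ _ := rfl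
  map_top' := rfl
  map_bot' := rfl

/-- The functor sending a bitopological space to the lattice `ℒ⁺`. -/
def posLatFunctor : BitopSpace.{u}ᵒᵖ ⥤ BddDistLat.{u} where
  obj X := BddDistLat.of X.unop.posSublattice
  map f := BddDistLat.ofHom (Hom.preimage f.unop)
  map_id _ := rfl
  map_comp _ _ := rfl

theorem compl_mem_negLat {X : BitopSpace.{u}} {U : Set X.carrier} (hU : U ∈ X.posLat) :
    Uᶜ ∈ X.negLat :=
  ⟨hU.2, by rw [compl_compl]; exact hU.1⟩

theorem compl_mem_posLat {X : BitopSpace.{u}} {U : Set X.carrier} (hU : U ∈ X.negLat) :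
    Uᶜ ∈ X.posLat :=
  ⟨hU.2, by rw [compl_compl]; exact hU.1⟩

/-! ### Points as prime filters, and full faithfulness -/

namespace SpectrumAxioms

variable {X Y : BitopSpace.{u}}

/-- The members of `ℒ⁺` separate the points of an abstract spectrum. -/
theorem ext_posLat (h : X.SpectrumAxioms) {x y : X.carrier}
    (hxy : ∀ U ∈ X.posLat, x ∈ U ↔ y ∈ U) : x = y := by
  rcases h.t0 with h0 | h0
  · let _ := X.pos
    exact (h.basis_pos.inseparable_iff.2 hxy).eq
  · let _ := X.neg
    refine (h.basis_neg.inseparable_iff.2 fun U hU => ?_).eq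
    simpa using not_congr (hxy Uᶜ (compl_mem_posLat hU))

/-- Every prime filter of `ℒ⁺` is the filter of the members of `ℒ⁺` containing some point. -/
theorem exists_point (h : X.SpectrumAxioms) (p : BoundedLatticeHom X.posSublattice Prop) :
    ∃ x : X.carrier, ∀ U : X.posSublattice, x ∈ (U : Set X.carrier) ↔ p U := by
  -- The wanted points lie in `F` and in every `U` with `p U`. As `F` is `𝒯⁻`-compact and these `U`
  -- are `𝒯⁻`-closed, the finite intersection property suffices.
  set F : Set X.carrier := ⋂ V : {V : X.posSublattice // ¬ p V}, ((V : X.posSublattice) : Set _)ᶜ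
    with hF
  have hFc : Fᶜ = ⋃ V : {V : X.posSublattice // ¬ p V}, ((V : X.posSublattice) : Set _) := by
    simp [hF, compl_iInter]
  have hFcomp : @IsCompact _ X.neg F := by
    refine h.compact_neg F ?_
    let _ := X.pos
    rw [hFc]
    exact isOpen_iUnion fun V => V.1.2.1
  -- Otherwise the `𝒯⁺`-compact set `U` is covered by the sets outside the filter. Primeness makes
  -- these directed, so a single one contains `U`.
  have hne : ∀ U : X.posSublattice, p U → (F ∩ U).Nonempty := by
    intro U hU
    by_contra hemp
    have hsub : (U : Set X.carrier) ⊆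
        ⋃ V : {V : X.posSublattice // ¬ p V}, ((V : X.posSublattice) : Set _) := by
      rw [← hFc]
      exact fun x hxU hxF => hemp ⟨x, hxF, hxU⟩
    have hUcomp := h.compact_pos U U.2.2
    let _ := X.pos
    have : Nonempty {V : X.posSublattice // ¬ p V} := ⟨⟨⊥, by simp⟩⟩
    obtain ⟨V, hV⟩ := hUcomp.elim_directed_cover _ (fun V => V.1.2.1) hsub (by
      intro V W
      refine ⟨⟨V.1 ⊔ W.1, by simp [V.2, W.2]⟩, ?_, ?_⟩
      · exact subset_union_left
      · exact subset_union_right)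
    exact V.2 (OrderHomClass.mono p (show U ≤ V.1 from hV) hU)
  let _ := X.neg
  have : Nonempty {U : X.posSublattice // p U} := ⟨⟨⊤, by simp⟩⟩
  obtain ⟨x, hxF, hx⟩ := hFcomp.inter_iInter_nonempty
    (fun U : {U : X.posSublattice // p U} => ((U : X.posSublattice) : Set _))
    (fun U => ⟨U.1.2.2⟩) (by
      intro u
      have : p (u.inf Subtype.val) := by
        rw [map_finset_inf]
        simp only [Finset.inf_eq_iInf, iInf_Prop_eq]
        exact fun U _ => U.2
      obtain ⟨x, hxF, hx⟩ := hne _ this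
      refine ⟨x, hxF, mem_iInter₂.2 fun U hU => ?_⟩
      exact (show u.inf Subtype.val ≤ U.1 from Finset.inf_le hU) hx)
  refine ⟨x, fun U => ⟨fun hxU => ?_, fun hU => mem_iInter.1 hx ⟨U, hU⟩⟩⟩
  by_contra hU
  exact mem_iInter.1 hxF ⟨U, hU⟩ hxU

theorem preimage_injective (hY : Y.SpectrumAxioms) :
    Function.Injective (Hom.preimage : Hom X Y → _) := by
  intro f g hfg
  refine Hom.ext (funext fun x => hY.ext_posLat fun U hU => ?_)
  exact Set.ext_iff.1 (congrArg Subtype.val (DFunLike.congr_fun hfg ⟨U, hU⟩)) x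

/-- Evaluation at a point `x`, as a homomorphism from `ℒ⁺` to the truth values. -/
def evalHom (x : X.carrier) : BoundedLatticeHom X.posSublattice Prop where
  toFun U := x ∈ (U : Set X.carrier)
  map_sup' _ _ := rfl
  map_inf' _ _ := rfl
  map_top' := rfl
  map_bot' := rfl

theorem preimage_surjective (hY : Y.SpectrumAxioms) :
    Function.Surjective (Hom.preimage : Hom X Y → _) := by
  intro φ
  choose f hf using fun x : X.carrier => hY.exists_point ((evalHom x).comp φ)
  have hpre : ∀ U : Y.posSublattice, f ⁻¹' U = φ U := fun U => Set.ext fun x => hf x U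
  refine ⟨⟨f, ?_, ?_⟩, ?_⟩
  · let _ := X.pos
    let _ := Y.pos
    refine hY.basis_pos.continuous_iff.2 fun U hU => ?_
    rw [hpre ⟨U, hU⟩]
    exact (φ ⟨U, hU⟩).2.1
  · let _ := X.neg
    let _ := Y.neg
    refine hY.basis_neg.continuous_iff.2 fun U hU => ?_
    have := (φ ⟨Uᶜ, compl_mem_posLat hU⟩).2.2
    rwa [← hpre, ← preimage_compl, compl_compl] at this
  · exact DFunLike.ext _ _ fun U => Subtype.ext (hpre U)

end SpectrumAxioms

/-! ### The space of prime filters of a lattice -/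

section PrimeSpace

variable (L : Type u) [DistribLattice L] [BoundedOrder L]

variable {L} in
/-- The points (prime filters, as homomorphisms to the truth values) at which `a` holds. -/
def basicOpen (a : L) : Set (BoundedLatticeHom L Prop) := {x | x a}

/-- The bitopological space of prime filters of a bounded distributive lattice. -/
def primeSpace : BitopSpace.{u} where
  carrier := BoundedLatticeHom L Prop
  pos := generateFrom (range (basicOpen (L := L)))
  neg := generateFrom (range fun a : L => (basicOpen a)ᶜ)

variable {L}

theorem basicOpen_sup (a b : L) : basicOpen (a ⊔ b) = basicOpen a ∪ basicOpen b := by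
  ext x; simp [basicOpen]

theorem basicOpen_inf (a b : L) : basicOpen (a ⊓ b) = basicOpen a ∩ basicOpen b := by
  ext x; simp [basicOpen]

theorem basicOpen_top : basicOpen (⊤ : L) = univ := by
  ext x; simp [basicOpen]

theorem basicOpen_bot : basicOpen (⊥ : L) = ∅ := by
  ext x; simp [basicOpen]

/-- If `a ≰ b`, the prime ideal theorem yields a prime ideal containing `b` but not `a`; its
complement is a point separating them. -/
theorem basicOpen_subset_iff {a b : L} : basicOpen a ⊆ basicOpen b ↔ a ≤ b := by
  refine ⟨fun h => ?_, fun h x hx => OrderHomClass.mono x h hx⟩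
  by_contra hab
  obtain ⟨J, hJ, hbJ, haJ⟩ := DistribLattice.prime_ideal_of_disjoint_filter_ideal
    (F := Order.PFilter.principal a) (I := Order.Ideal.principal b)
    (Set.disjoint_left.2 fun c hac hcb => hab (le_trans hac hcb))
  let x : BoundedLatticeHom L Prop :=
    { toFun := fun c => c ∉ J
      map_sup' := fun c d => by
        simp only [Order.Ideal.sup_mem_iff, sup_Prop_eq, eq_iff_iff]
        tauto
      map_inf' := fun c d => propext
        ⟨fun h => ⟨fun hc => h (J.lower inf_le_left hc), fun hd => h (J.lower inf_le_right hd)⟩,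
          fun h hcd => (hJ.mem_or_mem hcd).elim h.1 h.2⟩
      map_top' := eq_true hJ.toIsProper.top_notMem
      map_bot' := eq_false (not_not.2 J.bot_mem) }
  have hx : x ∈ basicOpen a := fun h => Set.disjoint_left.1 haJ (le_refl a) h
  exact h hx (hbJ (Order.Ideal.mem_principal.2 le_rfl))

theorem basicOpen_mem_posLat (a : L) : basicOpen a ∈ (primeSpace L).posLat :=
  ⟨isOpen_generateFrom_of_mem ⟨a, rfl⟩, isOpen_generateFrom_of_mem ⟨a, rfl⟩⟩

theorem isTopologicalBasis_basicOpen :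
    @IsTopologicalBasis (BoundedLatticeHom L Prop) (primeSpace L).pos (range (basicOpen (L := L))) := by
  let _ : TopologicalSpace (BoundedLatticeHom L Prop) := (primeSpace L).pos
  refine ⟨?_, ?_, rfl⟩
  · rintro _ ⟨a, rfl⟩ _ ⟨b, rfl⟩ x hx
    exact ⟨_, ⟨a ⊓ b, rfl⟩, by rwa [basicOpen_inf], (basicOpen_inf a b).subset⟩
  · exact eq_univ_of_univ_subset (subset_sUnion_of_mem ⟨⊤, basicOpen_top⟩)

theorem isTopologicalBasis_compl_basicOpen :
    @IsTopologicalBasis (BoundedLatticeHom L Prop) (primeSpace L).neg (range fun a : L => (basicOpen a)ᶜ) := by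
  let _ : TopologicalSpace (BoundedLatticeHom L Prop) := (primeSpace L).neg
  refine ⟨?_, ?_, rfl⟩
  · rintro _ ⟨a, rfl⟩ _ ⟨b, rfl⟩ x hx
    have h : (basicOpen (a ⊔ b))ᶜ = (basicOpen a)ᶜ ∩ (basicOpen b)ᶜ := by
      rw [basicOpen_sup, compl_union]
    exact ⟨_, ⟨a ⊔ b, rfl⟩, h.superset hx, h.subset⟩
  · exact eq_univ_of_univ_subset
      (subset_sUnion_of_mem ⟨⊥, by simp [basicOpen_bot]⟩)

/-- The limit of an ultrafilter on the space of prime filters, for both topologies. -/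
def ultrafilterLimit (𝒰 : Ultrafilter (BoundedLatticeHom L Prop)) : BoundedLatticeHom L Prop where
  toFun a := basicOpen a ∈ 𝒰
  map_sup' a b := propext (by rw [basicOpen_sup]; exact Ultrafilter.union_mem_iff)
  map_inf' a b := propext (by rw [basicOpen_inf]; exact inter_mem_iff)
  map_top' := eq_true (by rw [basicOpen_top]; exact univ_mem)
  map_bot' := eq_false (by rw [basicOpen_bot]; exact 𝒰.empty_notMem)

theorem le_nhds_pos_ultrafilterLimit (𝒰 : Ultrafilter (BoundedLatticeHom L Prop)) :
    (𝒰 : Filter _) ≤ @nhds (BoundedLatticeHom L Prop) (primeSpace L).pos (ultrafilterLimit 𝒰) := by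
  refine (le_iInf₂ ?_).trans_eq nhds_generateFrom.symm
  rintro _ ⟨hx, a, rfl⟩
  exact le_principal_iff.2 hx

theorem le_nhds_neg_ultrafilterLimit (𝒰 : Ultrafilter (BoundedLatticeHom L Prop)) :
    (𝒰 : Filter _) ≤ @nhds (BoundedLatticeHom L Prop) (primeSpace L).neg (ultrafilterLimit 𝒰) := by
  refine (le_iInf₂ ?_).trans_eq nhds_generateFrom.symm
  rintro _ ⟨hx, a, rfl⟩
  exact le_principal_iff.2 (Ultrafilter.compl_mem_iff_notMem.2 hx)

variable (L) in
theorem primeSpace_spectrumAxioms : (primeSpace L).SpectrumAxioms where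
  basis_pos := by
    let _ := (primeSpace L).pos
    refine isTopologicalBasis_basicOpen.of_isOpen_of_subset (fun U hU => hU.1) ?_
    rintro _ ⟨a, rfl⟩
    exact basicOpen_mem_posLat a
  basis_neg := by
    let _ := (primeSpace L).neg
    refine isTopologicalBasis_compl_basicOpen.of_isOpen_of_subset (fun U hU => hU.1) ?_
    rintro _ ⟨a, rfl⟩
    exact compl_mem_negLat (basicOpen_mem_posLat a)
  -- An ultrafilter has a common limit in both topologies: closedness in one puts it in `F`,
  -- convergence in the other gives compactness.
  compact_neg F hF := by
    refine (@isCompact_iff_ultrafilter_le_nhds _ (primeSpace L).neg F).2 fun 𝒰 h𝒰 =>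
      ⟨ultrafilterLimit 𝒰, ?_, le_nhds_neg_ultrafilterLimit 𝒰⟩
    let _ := (primeSpace L).pos
    exact isClosed_iff_ultrafilter.1 ⟨hF⟩ _ 𝒰 (le_nhds_pos_ultrafilterLimit 𝒰)
      (le_principal_iff.1 h𝒰)
  compact_pos F hF := by
    refine (@isCompact_iff_ultrafilter_le_nhds _ (primeSpace L).pos F).2 fun 𝒰 h𝒰 =>
      ⟨ultrafilterLimit 𝒰, ?_, le_nhds_pos_ultrafilterLimit 𝒰⟩
    let _ := (primeSpace L).neg
    exact isClosed_iff_ultrafilter.1 ⟨hF⟩ _ 𝒰 (le_nhds_neg_ultrafilterLimit 𝒰)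
      (le_principal_iff.1 h𝒰)
  t0 := by
    let _ := (primeSpace L).pos
    refine Or.inl ⟨fun x y hxy => DFunLike.ext (F := BoundedLatticeHom L Prop) x y fun a => propext ?_⟩
    exact hxy.mem_open_iff (basicOpen_mem_posLat a).1

/-- Such a `U` is `𝒯⁺`-compact and open, hence a finite union of basic sets, which is the basic set
of the join. -/
theorem exists_basicOpen_eq {U : Set (BoundedLatticeHom L Prop)}
    (hU : U ∈ (primeSpace L).posLat) : ∃ a : L, basicOpen a = U := by
  have hcomp := (primeSpace_spectrumAxioms L).compact_pos U hU.2
  let _ : TopologicalSpace (BoundedLatticeHom L Prop) := (primeSpace L).pos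
  obtain ⟨s, hs, hUs⟩ :=
    eq_finite_iUnion_of_isTopologicalBasis_of_isCompact_open (basicOpen (L := L))
      isTopologicalBasis_basicOpen U hcomp hU.1
  refine ⟨hs.toFinset.sup id, ?_⟩
  rw [hUs]
  ext x
  simp [basicOpen, map_finset_sup, Finset.sup_eq_iSup]

variable (L) in
/-- A bounded distributive lattice is the lattice `ℒ⁺` of its space of prime filters. -/
noncomputable def basicOpenIso : L ≃o (primeSpace L).posSublattice where
  toEquiv := Equiv.ofBijective
    (fun a => (⟨basicOpen a, basicOpen_mem_posLat a⟩ : (primeSpace L).posSublattice))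
    ⟨fun a b hab => by
      have h : basicOpen a = basicOpen b := congrArg Subtype.val hab
      exact le_antisymm (basicOpen_subset_iff.1 h.subset) (basicOpen_subset_iff.1 h.superset),
    fun U => (exists_basicOpen_eq U.2).imp fun _ ha => Subtype.ext ha⟩
  map_rel_iff' := basicOpen_subset_iff

end PrimeSpace

/-! ### The two equivalences -/

theorem bot_ne_top_posSublattice_iff (X : BitopSpace.{u}) :
    (⊥ : X.posSublattice) ≠ ⊤ ↔ Nonempty X.carrier := by
  refine (Subtype.ext_iff.not).trans ?_
  change (∅ : Set X.carrier) ≠ univ ↔ _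
  rw [ne_comm, ← nonempty_iff_ne_empty, nonempty_iff_univ_nonempty]

/-- A general `P` serves both categories of spectra. -/
theorem posLatFunctor_faithful {P : ObjectProperty BitopSpace.{u}}
    (hP : ∀ X, P X → X.SpectrumAxioms) : (P.ι.op ⋙ posLatFunctor).Faithful where
  map_injective {X _ f g} hfg := by
    refine Quiver.Hom.unop_inj (P.hom_ext ?_)
    exact (hP _ X.unop.property).preimage_injective (congrArg BddDistLat.Hom.hom hfg)

theorem posLatFunctor_full {P : ObjectProperty BitopSpace.{u}}
    (hP : ∀ X, P X → X.SpectrumAxioms) : (P.ι.op ⋙ posLatFunctor).Full where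
  map_surjective {X _} φ := by
    obtain ⟨f, hf⟩ := (hP _ X.unop.property).preimage_surjective (BddDistLat.Hom.hom φ)
    exact ⟨Quiver.Hom.op (ObjectProperty.homMk f), BddDistLat.hom_ext hf⟩

/-- The functor `ℒ⁺` from non-empty abstract spectra to lattices with `0 ≠ 1`. -/
def nontrivialPosLatFunctor : AbstractSpectrum.{u}ᵒᵖ ⥤ NontrivialBddDistLat.{u} :=
  BddDistLat.isNontrivial.lift (isAbstractSpectrum.ι.op ⋙ posLatFunctor)
    fun X => (bot_ne_top_posSublattice_iff X.unop.obj).2 X.unop.property.1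

theorem posLatFunctor_isEquivalence :
    (isPossiblyEmptyAbstractSpectrum.{u}.ι.op ⋙ posLatFunctor).IsEquivalence where
  faithful := posLatFunctor_faithful fun _ h => h
  full := posLatFunctor_full fun _ h => h
  essSurj := ⟨fun L => ⟨.op ⟨primeSpace L, primeSpace_spectrumAxioms L⟩,
    ⟨BddDistLat.Iso.mk (basicOpenIso L).symm⟩⟩⟩

theorem nontrivialPosLatFunctor_isEquivalence :
    nontrivialPosLatFunctor.{u}.IsEquivalence where
  faithful :=
    have := posLatFunctor_faithful (P := isAbstractSpectrum.{u}) fun _ h => h.2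
    Functor.Faithful.of_comp_iso (BddDistLat.isNontrivial.liftCompιIso _ _)
  full :=
    have := posLatFunctor_full (P := isAbstractSpectrum.{u}) fun _ h => h.2
    Functor.Full.of_comp_faithful_iso (BddDistLat.isNontrivial.liftCompιIso _ _)
  essSurj := ⟨fun L => by
    have hne : Nonempty (primeSpace L.obj).carrier := by
      rw [← bot_ne_top_posSublattice_iff, ← (basicOpenIso L.obj).map_bot,
        ← (basicOpenIso L.obj).map_top]
      exact (basicOpenIso L.obj).injective.ne L.property
    exact ⟨.op ⟨primeSpace L.obj, hne, primeSpace_spectrumAxioms L.obj⟩,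
      ⟨BddDistLat.isNontrivial.isoMk (BddDistLat.Iso.mk (basicOpenIso L.obj).symm)⟩⟩⟩

end BitopSpace

/-- The category of possibly empty abstract spectra is dual to the category of all bounded
distributive lattices, and the category of non-empty abstract spectra is dual to the category of
bounded distributive lattices with `0 ≠ 1`. -/
theorem corollary2p3p12 :
    Nonempty (PossiblyEmptyAbstractSpectrum.{u}ᵒᵖ ≌ BddDistLat.{u}) ∧
      Nonempty (AbstractSpectrum.{u}ᵒᵖ ≌ NontrivialBddDistLat.{u}) := by
  have := BitopSpace.posLatFunctor_isEquivalence.{u}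
  have := BitopSpace.nontrivialPosLatFunctor_isEquivalence.{u}
  exact ⟨⟨(BitopSpace.isPossiblyEmptyAbstractSpectrum.ι.op ⋙
    BitopSpace.posLatFunctor).asEquivalence⟩, ⟨BitopSpace.nontrivialPosLatFunctor.asEquivalence⟩⟩
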